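/- All graphs are finite and simple, all asymptotic notation refers to a family $(\Gamma^{(n)})_{n\in\mathbb N}$ of graphs as $n\to\infty$ (the index $n$ is suppressed), and the integers $m,i$ with $m\ge 3$ and $0\le i\le m-3$ are fixed. **Definitions.** A $k$-regular graph of order $v$ that is neither complete nor edgeless is *approximately strongly regular with parameters* $(v,k,\lambda,\mu;\sigma)$, where $\sigma\ge 0$, if the number of common neighbours of a pair of adjacent vertices has mean $\lambda$ and variance at most $\sigma^2$, and the number of common neighbours of a pair of distinct nonadjacent vertices has mean $\mu$ and variance at most $\sigma^2$ (averages over all such pairs). A family of $k$-regular graphs is *optimally pseudorandom* if the second largest absolute value of an eigenvalue of the adjacency matrix (that is, $\max_{j\ge 2}|u_j|$, where $u_1\ge u_2\ge\dots\ge u_v$ are the eigenvalues with multiplicity) is $O(\sqrt k)$. Let $\Gamma$ be an optimally pseudorandom family of $K_m$-free $k$-regular graphs of order $v$, let $Y$ be a clique of size $i$ in $\Gamma$, and let $\Gamma_i$ be the subgraph of $\Gamma$ induced on the set of common neighbours of $Y$. Consider the following properties. * (P1) $\Gamma_i$ has $v_i$ vertices and $\frac12 v_ik_i$ edges, where $k_i\ge(1+o(1))\,k\left(\frac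 kv\right)^i$ and $(1+o(1))\frac kv\le\frac{k_i}{v_i}=o(1)$. * (P2) For all large $n$, $\Gamma_i$ is approximately strongly regular with parameters $(v_i,k_i,\lambda_i,\mu_i;\sigma_i)$ for some $\lambda_i,\mu_i,\sigma_i$, and its smallest eigenvalue $s_i$ satisfies $-s_i=O(\mu_i-\lambda_i)$, that is, there is a constant $C>0$ with $-s_i\le C(\mu_i-\lambda_i)$ for all large $n$. **Proposition.** Suppose that $k=\omega\bigl(v^{1-\frac1{3m-2i-5}}\bigr)$, that $\Gamma_i$ is regular and has property (P1), and that $\Gamma_i$ has property (P2) or $i=m-3$. Then, for all large $n$, $\Gamma_i$ is approximately strongly regular with parameters $(v_i,k_i,\lambda_i,\mu_i;\sigma_i)$ for some $\lambda_i,\mu_i,\sigma_i$, and whenever $\lambda_i,\mu_i,\sigma_i$ are such parameters for all large $n$, $$\sigma_i=\Omega\!\left(\sqrt k\left(\tfrac kv\right)^{\frac32m-2-i}\right),$$ that is, there is a constant $c>0$ such that $\sigma_i\ge c\sqrt k\,(k/v)^{\frac32m-2-i}$ for all large $n$. -/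

import Mathlib

open Filter Topology Asymptotics
open scoped Classical

noncomputable section

namespace SimpleGraph

variable {V : Type*} [Fintype V]

/-- The number of common neighbours of `a` and `b`. -/
def commonCount (G : SimpleGraph V) (a b : V) : ℕ :=
  Fintype.card (G.commonNeighbors a b)

/-- The ordered pairs of adjacent vertices. -/
def adjPairs (G : SimpleGraph V) : Finset (V × V) :=
  Finset.univ.filter fun p => G.Adj p.1 p.2

/-- The ordered pairs of distinct nonadjacent vertices. -/
def nonadjPairs (G : SimpleGraph V) : Finset (V × V) :=
  Finset.univ.filter fun p => p.1 ≠ p.2 ∧ ¬ G.Adj p.1 p.2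

/-- The average over `(a, b) ∈ S` of the number of common neighbours of `a` and `b`. -/
def meanCommon (G : SimpleGraph V) (S : Finset (V × V)) : ℝ :=
  (∑ p ∈ S, (G.commonCount p.1 p.2 : ℝ)) / (S.card : ℝ)

/-- The average over `(a, b) ∈ S` of the squared deviation from `x` of the number of common
neighbours of `a` and `b`. -/
def varCommon (G : SimpleGraph V) (S : Finset (V × V)) (x : ℝ) : ℝ :=
  (∑ p ∈ S, ((G.commonCount p.1 p.2 : ℝ) - x) ^ 2) / (S.card : ℝ)

/-- `G` is approximately strongly regular with parameters `(v, k, lam, mu; sigma)`. -/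
structure IsApproxSRG (G : SimpleGraph V) (v k : ℕ) (lam mu sigma : ℝ) : Prop where
  card : Fintype.card V = v
  regular : G.IsRegularOfDegree k
  not_complete : G ≠ ⊤
  not_edgeless : G ≠ ⊥
  sigma_nonneg : 0 ≤ sigma
  mean_adj : G.meanCommon G.adjPairs = lam
  var_adj : G.varCommon G.adjPairs lam ≤ sigma ^ 2
  mean_nonadj : G.meanCommon G.nonadjPairs = mu
  var_nonadj : G.varCommon G.nonadjPairs mu ≤ sigma ^ 2

/-- The smallest eigenvalue of the adjacency matrix. -/
def smallestEigenvalue (G : SimpleGraph V) : ℝ :=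
  ⨅ j : V, (G.isHermitian_adjMatrix ℝ).eigenvalues j

/-- The second largest absolute value of an eigenvalue of the adjacency matrix of a regular graph:
`max |u_j|` over `j ≥ 2`, where `u_1 ≥ u_2 ≥ ⋯ ≥ u_v` are the eigenvalues with multiplicity
(for a `k`-regular graph, `u_1 = k` has the largest absolute value). The function `eigenvalues₀`
lists the eigenvalues in decreasing order, starting with the index `0`. -/
def secondAbsEigenvalue (G : SimpleGraph V) : ℝ :=
  ⨆ j : {j : Fin (Fintype.card V) // (j : ℕ) ≠ 0},
    |(G.isHermitian_adjMatrix ℝ).eigenvalues₀ j|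

/-- The common neighbourhood of a set `Y` of vertices. -/
def commonNbhd (G : SimpleGraph V) (Y : Finset V) : Set V :=
  {x | ∀ y ∈ Y, G.Adj y x}

/-- The subgraph induced on the common neighbourhood of `Y`. -/
abbrev commonNbhdGraph (G : SimpleGraph V) (Y : Finset V) : SimpleGraph (G.commonNbhd Y) :=
  G.induce (G.commonNbhd Y)

end SimpleGraph

/-- A family of graphs, the `n`-th one `k n`-regular, is optimally pseudorandom if the second
largest absolute value of an eigenvalue is `O(√k)`. -/
def OptimallyPseudorandom {V : ℕ → Type*} [∀ n, Fintype (V n)]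
    (G : ∀ n, SimpleGraph (V n)) (k : ℕ → ℕ) : Prop :=
  (∀ n, (G n).IsRegularOfDegree (k n)) ∧
    (fun n => (G n).secondAbsEigenvalue) =O[atTop] fun n => √(k n : ℝ)

/-- Property (P1) of a family of graphs `H n` of order `vᵢ n` and average degree `kᵢ n`, relative
to the sequences `v`, `k` and the number `i`. The sequences `e₁`, `e₂` are the terms `o(1)`. -/
structure PropertyP1 {W : ℕ → Type*} [∀ n, Fintype (W n)] (H : ∀ n, SimpleGraph (W n))
    (v k : ℕ → ℝ) (i : ℕ) (vi : ℕ → ℕ) (ki : ℕ → ℝ) : Prop where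
  card_vertices : ∀ n, Fintype.card (W n) = vi n
  card_edges : ∀ n, ((H n).edgeFinset.card : ℝ) = 1 / 2 * vi n * ki n
  degree_ge : ∃ e₁ : ℕ → ℝ, Tendsto e₁ atTop (𝓝 0) ∧
    ∀ᶠ n in atTop, (1 + e₁ n) * (k n * (k n / v n) ^ i) ≤ ki n
  density_ge : ∃ e₂ : ℕ → ℝ, Tendsto e₂ atTop (𝓝 0) ∧
    ∀ᶠ n in atTop, (1 + e₂ n) * (k n / v n) ≤ ki n / vi n
  density_tendsto : Tendsto (fun n => ki n / vi n) atTop (𝓝 0)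

/-- Property (P2) of a family of graphs `H n`: for all large `n`, the graph `H n` is approximately
strongly regular with parameters `(vᵢ, kᵢ, lam, mu; sigma)`, and its smallest eigenvalue `s`
satisfies `-s = O(mu - lam)`, a one-sided bound in which `mu - lam` enters with its sign. -/
def PropertyP2 {W : ℕ → Type*} [∀ n, Fintype (W n)] (H : ∀ n, SimpleGraph (W n))
    (vi ki : ℕ → ℕ) : Prop :=
  ∃ lam mu sigma : ℕ → ℝ,
    (∀ᶠ n in atTop, (H n).IsApproxSRG (vi n) (ki n) (lam n) (mu n) (sigma n)) ∧
    ∃ C : ℝ, 0 < C ∧ ∀ᶠ n in atTop, -(H n).smallestEigenvalue ≤ C * (mu n - lam n)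

end

/-! Write `d`, `N`, `δ = d / N` for the degree, order and density of the local graph and `A` for its
adjacency matrix. The proof combines a clique bound with a robust Krein condition. Cliques: if the
smallest eigenvalue `s` is small in absolute value, every large vertex set contains a vertex with
many neighbours in it, and iterating builds a clique. Being `K_{j+3}`-free, with `m = i + 3 + j`,
thus forces `-s` to be at least of order `d δ ^ (j + 1)`, and (P2) passes this bound to `τ = mu -
lam`. For `j = 0`, triangle-freeness gives `lam = 0`, and counting paths of length two bounds `mu`
directly (`exists_degree_mul_density_pow_le`). Krein: take `M = R I - A + c J` with row sums zero
and `R ≥ d / τ`. For an exactly strongly regular graph, `M` is positive semidefinite, because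
eigenvalues of `A` other than `d` are at most `R`. In general its negative part `Q` has Frobenius
norm at most `sigma N / τ`. By the Schur product theorem the entrywise cube of `M + Q` has
nonnegative entry sum, whereas the cubes of the entries of `M` sum to at most `-N d / 3` when `R ^
3` is small against `d`. Hence `Q`, and with it `sigma`, cannot be small
(`IsApproxSRG.lt_sq_of_cube_le`). The hypothesis on `k` is what makes `R ^ 3` small against `d`. -/

namespace Matrix

/-! ### Negative parts and entrywise cubes of symmetric matrices. -/

variable {n : Type*} [Fintype n]

theorem sum_sq_eq_trace (X : Matrix n n ℝ) : ∑ a, ∑ b, X a b ^ 2 = (Xᵀ * X).trace := by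
  rw [Finset.sum_comm]
  simp [trace, mul_apply, sq]

theorem IsHermitian.exists_orthogonal {M : Matrix n n ℝ} (hM : M.IsHermitian) :
    ∃ U : Matrix n n ℝ, Uᵀ * U = 1 ∧ U * Uᵀ = 1 ∧ M = U * diagonal hM.eigenvalues * Uᵀ := by
  have hUU : (hM.eigenvectorUnitary : Matrix n n ℝ)ᵀ * hM.eigenvectorUnitary = 1 := by
    have := Unitary.coe_star_mul_self hM.eigenvectorUnitary
    rwa [star_eq_conjTranspose, conjTranspose_eq_transpose_of_trivial] at this
  refine ⟨hM.eigenvectorUnitary, hUU, mul_eq_one_comm.mp hUU, ?_⟩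
  have := hM.spectral_theorem
  rw [Unitary.conjStarAlgAut_apply, star_eq_conjTranspose,
    conjTranspose_eq_transpose_of_trivial] at this
  simpa using this

theorem posSemidef_mul_diagonal_mul_transpose (U : Matrix n n ℝ) {w : n → ℝ} (hw : ∀ l, 0 ≤ w l) :
    (U * diagonal w * Uᵀ).PosSemidef := by
  have := (PosSemidef.diagonal (d := w) hw).mul_mul_conjTranspose_same U
  rwa [conjTranspose_eq_transpose_of_trivial] at this

/-- If `E` is at least as large as `M` on the eigenvectors of `M` with negative eigenvalue, then the
negative part of `M` has at most the Frobenius norm of `E`. -/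
theorem IsHermitian.exists_posSemidef_sub {M E : Matrix n n ℝ} (hM : M.IsHermitian)
    (h : ∀ (x : n → ℝ) (ν : ℝ), ν < 0 → M *ᵥ x = ν • x →
      ν ^ 2 * (x ⬝ᵥ x) ≤ (E *ᵥ x) ⬝ᵥ (E *ᵥ x)) :
    ∃ P Q : Matrix n n ℝ, P.PosSemidef ∧ Q.PosSemidef ∧ M = P - Q ∧
      ∑ a, ∑ b, Q a b ^ 2 ≤ ∑ a, ∑ b, E a b ^ 2 := by
  obtain ⟨U, hUU, hUU', hspec⟩ := hM.exists_orthogonal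
  refine ⟨U * diagonal (fun l => max (hM.eigenvalues l) 0) * Uᵀ,
    U * diagonal (fun l => max (-hM.eigenvalues l) 0) * Uᵀ,
    posSemidef_mul_diagonal_mul_transpose U fun l => le_max_right _ _,
    posSemidef_mul_diagonal_mul_transpose U fun l => le_max_right _ _, ?_, ?_⟩
  · conv_lhs => rw [hspec]
    rw [← sub_mul, ← mul_sub, diagonal_sub]
    congr 3
    ext l
    rcases le_total (hM.eigenvalues l) 0 with h0 | h0
    · rw [max_eq_right h0, max_eq_left (by linarith)]; ring
    · rw [max_eq_left h0, max_eq_right (by linarith)]; ring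
  · rw [sum_sq_eq_trace, sum_sq_eq_trace]
    set D := diagonal (fun l => max (-hM.eigenvalues l) 0) with hD
    have h1 : ((U * D * Uᵀ)ᵀ * (U * D * Uᵀ)).trace = ∑ l, max (-hM.eigenvalues l) 0 ^ 2 := by
      have : (U * D * Uᵀ)ᵀ * (U * D * Uᵀ) = U * (D * D) * Uᵀ := by
        rw [transpose_mul, transpose_mul, transpose_transpose, hD, diagonal_transpose]
        calc U * (D * Uᵀ) * (U * D * Uᵀ) = U * (D * (Uᵀ * U) * D) * Uᵀ := by
              simp only [mul_assoc]
          _ = _ := by rw [hUU, mul_one]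
      rw [this, trace_mul_comm, ← mul_assoc, hUU, one_mul, hD, diagonal_mul_diagonal,
        trace_diagonal]
      simp [sq]
    -- The Frobenius norm is unchanged by right multiplication by `U`, so both sides can be compared
    -- one eigenvector at a time; `Uᵀ l` is the `l`-th one.
    have h2 : (Eᵀ * E).trace = ∑ l, (E *ᵥ Uᵀ l) ⬝ᵥ (E *ᵥ Uᵀ l) := by
      have h3 : (Eᵀ * E).trace = ((E * U)ᵀ * (E * U)).trace := by
        rw [transpose_mul, mul_assoc, trace_mul_comm Uᵀ]
        simp only [mul_assoc, hUU', mul_one]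
      rw [h3]
      simp only [trace, diag_apply, mul_apply, transpose_apply, dotProduct, mulVec]
    rw [h1, h2]
    refine Finset.sum_le_sum fun l _ => ?_
    rcases le_or_gt 0 (hM.eigenvalues l) with h0 | h0
    · rw [max_eq_right (by linarith)]
      simpa [dotProduct] using Finset.sum_nonneg fun a _ => mul_self_nonneg ((E *ᵥ Uᵀ l) a)
    · rw [max_eq_left (by linarith)]
      have hx : M *ᵥ Uᵀ l = hM.eigenvalues l • Uᵀ l := by
        have h4 : M * U = U * diagonal hM.eigenvalues := by
          conv_lhs => rw [hspec, mul_assoc, hUU, mul_one]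
        ext a
        have := congrFun (congrFun h4 a) l
        rw [mul_diagonal] at this
        rw [Pi.smul_apply, smul_eq_mul, mul_comm]
        exact this
      have hn : Uᵀ l ⬝ᵥ Uᵀ l = 1 := by
        have := congrFun (congrFun hUU l) l
        simpa [mul_apply, dotProduct] using this
      have := h _ _ h0 hx
      rw [hn] at this
      simpa using this

theorem PosSemidef.sum_sum_nonneg {P : Matrix n n ℝ} (hP : P.PosSemidef) :
    0 ≤ ∑ a, ∑ b, P a b := by
  have := hP.dotProduct_mulVec_nonneg (fun _ => (1 : ℝ))
  simpa [dotProduct, mulVec] using this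

/-- The sum of the cubes of the entries of a difference of positive semidefinite matrices. -/
theorem sum_cube_ge_of_eq_sub {M P Q : Matrix n n ℝ} (hP : P.PosSemidef) (hM : M = P - Q) :
    -(3 * ∑ a, ∑ b, M a b ^ 2 * Q a b + 3 * ∑ a, ∑ b, M a b * Q a b ^ 2 + ∑ a, ∑ b, Q a b ^ 3)
      ≤ ∑ a, ∑ b, M a b ^ 3 := by
  -- Schur product theorem, tested on the all-ones vector; the rest expands `P = M + Q`.
  have h := ((hP.hadamard hP).hadamard hP).sum_sum_nonneg
  have h2 : ∑ a, ∑ b, ((P ⊙ P) ⊙ P) a b = ∑ a, ∑ b, M a b ^ 3 +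
      (3 * ∑ a, ∑ b, M a b ^ 2 * Q a b + 3 * ∑ a, ∑ b, M a b * Q a b ^ 2 +
        ∑ a, ∑ b, Q a b ^ 3) := by
    simp only [Finset.mul_sum, ← Finset.sum_add_distrib]
    refine Finset.sum_congr rfl fun a _ => Finset.sum_congr rfl fun b _ => ?_
    simp only [hM, hadamard_apply, sub_apply]
    ring
  linarith

end Matrix

/-! ### The deviation from strong regularity as a matrix. -/

namespace SimpleGraph

open Matrix

variable {V : Type*} [Fintype V]

/-- The deviation of the number of common neighbours from `lam` on adjacent pairs and from `mu` on
nonadjacent pairs, as a matrix with zero diagonal. -/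
noncomputable def commonDev (G : SimpleGraph V) (lam mu : ℝ) : Matrix V V ℝ :=
  Matrix.of fun a b => if a = b then 0 else
    (G.commonCount a b : ℝ) - if G.Adj a b then lam else mu

theorem adjMatrix_mul_self_apply (G : SimpleGraph V) (a b : V) :
    (G.adjMatrix ℝ * G.adjMatrix ℝ) a b = G.commonCount a b := by
  rw [adjMatrix_mul_apply, commonCount]
  simp only [adjMatrix_apply, Finset.sum_boole]
  rw [← Set.toFinset_card]
  congr 2
  ext x
  simp [mem_commonNeighbors, adj_comm]

theorem commonCount_self {G : SimpleGraph V} {d : ℕ} (h : G.IsRegularOfDegree d) (a : V) :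
    (G.commonCount a a : ℝ) = d := by
  rw [← adjMatrix_mul_self_apply, adjMatrix_mul_self_apply_self]
  rw [← h a]

/-- The right-hand side vanishes exactly for strongly regular graphs. On vectors orthogonal to the
all-ones vector it is a quadratic polynomial in `A`. -/
theorem commonDev_eq {G : SimpleGraph V} {d : ℕ} (h : G.IsRegularOfDegree d) (lam mu : ℝ) :
    G.commonDev lam mu = G.adjMatrix ℝ * G.adjMatrix ℝ + (mu - lam) • G.adjMatrix ℝ -
      (d - mu) • (1 : Matrix V V ℝ) - mu • Matrix.of fun _ _ => (1 : ℝ) := by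
  ext a b
  simp only [Matrix.sub_apply, Matrix.add_apply, Matrix.smul_apply, adjMatrix_mul_self_apply,
    adjMatrix_apply, commonDev, of_apply, one_apply, smul_eq_mul]
  by_cases hab : a = b
  · subst hab
    simp [commonCount_self h]
  · by_cases hadj : G.Adj a b
    · simp [hab, hadj]; ring
    · simp [hab, hadj]

theorem sum_sq_commonDev_eq (G : SimpleGraph V) (lam mu : ℝ) :
    ∑ a, ∑ b, G.commonDev lam mu a b ^ 2 =
      ∑ p ∈ G.adjPairs, ((G.commonCount p.1 p.2 : ℝ) - lam) ^ 2 +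
        ∑ p ∈ G.nonadjPairs, ((G.commonCount p.1 p.2 : ℝ) - mu) ^ 2 := by
  rw [adjPairs, nonadjPairs, Finset.sum_filter, Finset.sum_filter, ← Finset.sum_add_distrib,
    Fintype.sum_prod_type]
  refine Finset.sum_congr rfl fun a _ => Finset.sum_congr rfl fun b _ => ?_
  by_cases hab : a = b
  · subst hab; simp [commonDev]
  · by_cases hadj : G.Adj a b <;> simp [commonDev, hab, hadj]

theorem card_adjPairs_add_card_nonadjPairs_le (G : SimpleGraph V) :
    G.adjPairs.card + G.nonadjPairs.card ≤ Fintype.card V ^ 2 := by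
  rw [← Finset.card_union_of_disjoint]
  · refine (Finset.card_le_univ _).trans ?_
    rw [Fintype.card_prod, sq]
  · rw [Finset.disjoint_left]
    intro p hp hp'
    simp only [adjPairs, nonadjPairs, Finset.mem_filter] at hp hp'
    exact hp'.2.2 hp.2

theorem sum_sq_le_of_varCommon_le {G : SimpleGraph V} {S : Finset (V × V)} {x y : ℝ}
    (h : G.varCommon S x ≤ y) :
    ∑ p ∈ S, ((G.commonCount p.1 p.2 : ℝ) - x) ^ 2 ≤ y * S.card := by
  rcases S.eq_empty_or_nonempty with rfl | hS
  · simp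
  · rwa [varCommon, div_le_iff₀ (by exact_mod_cast hS.card_pos)] at h

theorem IsApproxSRG.sum_sq_commonDev_le {G : SimpleGraph V} {N d : ℕ} {lam mu sigma : ℝ}
    (h : G.IsApproxSRG N d lam mu sigma) :
    ∑ a, ∑ b, G.commonDev lam mu a b ^ 2 ≤ (sigma * N) ^ 2 := by
  rw [sum_sq_commonDev_eq]
  have h1 := sum_sq_le_of_varCommon_le h.var_adj
  have h2 := sum_sq_le_of_varCommon_le h.var_nonadj
  have h3 : ((G.adjPairs.card : ℝ) + G.nonadjPairs.card) ≤ (N : ℝ) ^ 2 := by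
    have := G.card_adjPairs_add_card_nonadjPairs_le
    rw [h.card] at this
    exact_mod_cast this
  calc _ ≤ sigma ^ 2 * (G.adjPairs.card + G.nonadjPairs.card) := by
        rw [mul_add]; exact add_le_add h1 h2
    _ ≤ sigma ^ 2 * (N : ℝ) ^ 2 := by gcongr
    _ = _ := by ring

theorem meanCommon_nonneg (G : SimpleGraph V) (S : Finset (V × V)) : 0 ≤ G.meanCommon S :=
  div_nonneg (Finset.sum_nonneg fun _ _ => Nat.cast_nonneg _) (Nat.cast_nonneg _)

/-! ### The approximate Krein condition. -/

/-- The matrix `R I - A + c J`. -/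
noncomputable def shiftMatrix (G : SimpleGraph V) (R c : ℝ) : Matrix V V ℝ :=
  R • (1 : Matrix V V ℝ) - G.adjMatrix ℝ + c • Matrix.of fun _ _ => (1 : ℝ)

theorem isHermitian_shiftMatrix {W : Type*} (G : SimpleGraph W) (R c : ℝ) :
    (G.shiftMatrix R c).IsHermitian := by
  ext a b
  simp [shiftMatrix, one_apply, eq_comm, adj_comm]

theorem of_one_mulVec (x : V → ℝ) :
    (Matrix.of fun _ _ : V => (1 : ℝ)) *ᵥ x = fun _ => ∑ a, x a := by
  ext a; simp [mulVec, dotProduct]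

theorem sum_row_adjMatrix {G : SimpleGraph V} {d : ℕ} (h : G.IsRegularOfDegree d) (a : V) :
    ∑ b, G.adjMatrix ℝ a b = d := by
  simp only [adjMatrix_apply, Finset.sum_boole]
  rw [← h a, ← card_neighborFinset_eq_degree]
  congr 2
  ext b; simp

theorem sum_col_adjMatrix {G : SimpleGraph V} {d : ℕ} (h : G.IsRegularOfDegree d) (b : V) :
    ∑ a, G.adjMatrix ℝ a b = d := by
  rw [← sum_row_adjMatrix h b]
  exact Finset.sum_congr rfl fun a _ => by simp [adjMatrix_apply, adj_comm]

/-- Sums of functions of the entries of `R I - A + c J`. -/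
theorem sum_sum_shiftMatrix {G : SimpleGraph V} {d : ℕ} (h : G.IsRegularOfDegree d) (R c : ℝ)
    (f : ℝ → ℝ) :
    ∑ a, ∑ b, f (G.shiftMatrix R c a b) = Fintype.card V *
      (f (R + c) + d * f (c - 1) + (Fintype.card V - 1 - d) * f c) := by
  have key : ∀ a, ∑ b, f (G.shiftMatrix R c a b) =
      f (R + c) + d * f (c - 1) + (Fintype.card V - 1 - d) * f c := by
    intro a
    have : ∀ b, f (G.shiftMatrix R c a b) = (1 : Matrix V V ℝ) a b * (f (R + c) - f c) +
        G.adjMatrix ℝ a b * (f (c - 1) - f c) + f c := by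
      intro b
      simp only [shiftMatrix, Matrix.sub_apply, Matrix.add_apply, Matrix.smul_apply,
        adjMatrix_apply, of_apply,
        one_apply, smul_eq_mul]
      by_cases hab : a = b
      · subst hab; simp
      · by_cases hadj : G.Adj a b <;> simp [hab, hadj]
        congr 1; ring
    simp only [this, Finset.sum_add_distrib, ← Finset.sum_mul, sum_row_adjMatrix h]
    simp [one_apply]
    ring
  simp only [key, Finset.sum_const, Finset.card_univ, nsmul_eq_mul]

/-- A negative eigenvalue `ν` of the shifted matrix comes from an eigenvalue `R - ν > R` of `A`.
There the quadratic polynomial of strong regularity has value at least `-τ ν`, where `τ = mu - lam`.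
This is the hypothesis needed for `exists_posSemidef_sub`. -/
theorem IsApproxSRG.commonDev_ge_of_eigenvector {G : SimpleGraph V} {N d : ℕ}
    {lam mu sigma : ℝ} (h : G.IsApproxSRG N d lam mu sigma) (hlt : lam < mu) {R c : ℝ}
    (hR : d ≤ (mu - lam) * R) (hc : c * N = d - R) {x : V → ℝ} {ν : ℝ} (hν : ν < 0)
    (hx : G.shiftMatrix R c *ᵥ x = ν • x) :
    ν ^ 2 * (x ⬝ᵥ x) ≤ (((mu - lam)⁻¹ • G.commonDev lam mu) *ᵥ x) ⬝ᵥ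
      (((mu - lam)⁻¹ • G.commonDev lam mu) *ᵥ x) := by
  have hτ : 0 < mu - lam := sub_pos.mpr hlt
  have hmu : 0 ≤ mu := h.mean_nonadj ▸ G.meanCommon_nonneg _
  -- The choice of `c` makes all column sums zero, so eigenvectors with nonzero eigenvalue are
  -- orthogonal to the all-ones vector.
  have hsum : ∑ a, x a = 0 := by
    have h1 : ∑ a, (G.shiftMatrix R c *ᵥ x) a = 0 := by
      simp only [mulVec, dotProduct]
      rw [Finset.sum_comm]
      refine Finset.sum_eq_zero fun b _ => ?_
      rw [← Finset.sum_mul]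
      have : ∑ a, G.shiftMatrix R c a b = 0 := by
        simp only [shiftMatrix, Matrix.sub_apply, Matrix.add_apply, Matrix.smul_apply, of_apply,
          smul_eq_mul,
          Finset.sum_add_distrib, Finset.sum_sub_distrib, ← Finset.mul_sum,
          sum_col_adjMatrix h.regular]
        simp [one_apply, h.card]
        linarith
      rw [this, zero_mul]
    rw [hx] at h1
    simp only [Pi.smul_apply, smul_eq_mul, ← Finset.mul_sum] at h1
    exact (mul_eq_zero.mp h1).resolve_left hν.ne
  have hA : G.adjMatrix ℝ *ᵥ x = (R - ν) • x := by
    rw [shiftMatrix, add_mulVec, sub_mulVec, smul_mulVec, smul_mulVec, one_mulVec,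
      of_one_mulVec, hsum] at hx
    ext a
    have := congrFun hx a
    simp only [Pi.add_apply, Pi.sub_apply, Pi.smul_apply, smul_eq_mul] at this ⊢
    linarith
  set e : ℝ := (R - ν) ^ 2 + (mu - lam) * (R - ν) - (d - mu) with he
  have hE : G.commonDev lam mu *ᵥ x = e • x := by
    rw [commonDev_eq h.regular, sub_mulVec, sub_mulVec, add_mulVec, smul_mulVec, smul_mulVec,
      smul_mulVec, one_mulVec, of_one_mulVec, hsum, ← mulVec_mulVec, hA, mulVec_smul, hA]
    ext a
    simp only [Pi.add_apply, Pi.sub_apply, Pi.smul_apply, smul_eq_mul]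
    rw [he]; ring
  -- Drop the square and `mu ≥ 0` from `e`; the term `(mu - lam) * R` absorbs `d`.
  have hle : -ν ≤ (mu - lam)⁻¹ * e := by
    rw [← div_eq_inv_mul, le_div_iff₀ hτ, he]
    nlinarith [sq_nonneg (R - ν)]
  rw [smul_mulVec, hE, smul_smul, smul_dotProduct, dotProduct_smul, smul_eq_mul, smul_eq_mul,
    ← mul_assoc, ← sq]
  have hxx : 0 ≤ x ⬝ᵥ x := Finset.sum_nonneg fun a _ => mul_self_nonneg _
  refine mul_le_mul_of_nonneg_right ?_ hxx
  nlinarith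

/-- An approximate Krein condition: if `(d / (mu - lam)) ^ 3` is much smaller than `d`, then the
deviation from strong regularity is not small. -/
theorem IsApproxSRG.lt_sq_of_cube_le {G : SimpleGraph V} {N d : ℕ} {lam mu sigma : ℝ}
    (h : G.IsApproxSRG N d lam mu sigma) (hlt : lam < mu) {R : ℝ} (hR1 : 1 ≤ R)
    (hR : d ≤ (mu - lam) * R) (hR3 : 10000 * R ^ 3 ≤ d) (hN : 4 * d ≤ N) :
    d * (mu - lam) ^ 2 < 10000 * (sigma * N) ^ 2 := by
  by_contra! hcon
  have hτ : 0 < mu - lam := sub_pos.mpr hlt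
  have hRR : R ≤ R ^ 3 := by nlinarith [sq_nonneg (R - 1)]
  have hd : (10000 : ℝ) ≤ d := by linarith
  have hN' : (4 : ℝ) * d ≤ N := by exact_mod_cast hN
  have hN0 : (0 : ℝ) < N := by linarith
  set c : ℝ := (d - R) / N with hc
  have hcN : c * N = d - R := div_mul_cancel₀ _ hN0.ne'
  have hc0 : 0 ≤ c := div_nonneg (by linarith) hN0.le
  have hc4 : c ≤ 1 / 4 := by
    rw [hc, div_le_iff₀ hN0]; linarith
  obtain ⟨P, Q, hP, -, hM, hQ⟩ := (G.isHermitian_shiftMatrix R c).exists_posSemidef_sub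
    (E := (mu - lam)⁻¹ • G.commonDev lam mu)
    fun x ν hν hx => h.commonDev_ge_of_eigenvector hlt hR hcN hν hx
  have hF : ∑ a, ∑ b, Q a b ^ 2 ≤ d / 10000 := by
    refine hQ.trans ?_
    simp only [Matrix.smul_apply, smul_eq_mul, mul_pow, ← Finset.mul_sum]
    calc _ ≤ ((mu - lam)⁻¹) ^ 2 * (sigma * N) ^ 2 := by
          gcongr; exact h.sum_sq_commonDev_le
      _ ≤ d / 10000 := by
          rw [inv_pow, inv_mul_le_iff₀ (by positivity)]
          linarith
  have hF0 : 0 ≤ ∑ a, ∑ b, Q a b ^ 2 :=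
    Finset.sum_nonneg fun a _ => Finset.sum_nonneg fun b _ => sq_nonneg _
  have hS := sum_cube_ge_of_eq_sub hP hM
  have hMle : ∀ a b, G.shiftMatrix R c a b ≤ 2 * R := by
    intro a b
    simp only [shiftMatrix, Matrix.sub_apply, Matrix.add_apply, Matrix.smul_apply,
        adjMatrix_apply, of_apply,
      one_apply, smul_eq_mul]
    split_ifs <;> linarith
  have hQle : ∀ a b, Q a b ≤ N := by
    intro a b
    have h1 : Q a b ^ 2 ≤ ∑ a, ∑ b, Q a b ^ 2 :=
      (Finset.single_le_sum (f := fun b => Q a b ^ 2) (fun b _ => sq_nonneg _)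
        (Finset.mem_univ b)).trans
        (Finset.single_le_sum (f := fun a => ∑ b, Q a b ^ 2)
          (fun a _ => Finset.sum_nonneg fun b _ => sq_nonneg _) (Finset.mem_univ a))
    refine le_of_sq_le_sq ?_ hN0.le
    nlinarith
  have hMQ2 : ∑ a, ∑ b, G.shiftMatrix R c a b * Q a b ^ 2 ≤ 2 * R * (d / 10000) := by
    calc _ ≤ ∑ a, ∑ b, 2 * R * Q a b ^ 2 := by
          gcongr with a _ b _; exact hMle a b
      _ = 2 * R * ∑ a, ∑ b, Q a b ^ 2 := by simp only [Finset.mul_sum]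
      _ ≤ _ := by gcongr
  have hQ3 : ∑ a, ∑ b, Q a b ^ 3 ≤ N * (d / 10000) := by
    calc _ ≤ ∑ a, ∑ b, N * Q a b ^ 2 := by
          gcongr with a _ b _
          rw [pow_succ']
          exact mul_le_mul_of_nonneg_right (hQle a b) (sq_nonneg _)
      _ = N * ∑ a, ∑ b, Q a b ^ 2 := by simp only [Finset.mul_sum]
      _ ≤ _ := by gcongr
  -- Fourth powers are needed for Cauchy–Schwarz on the sum of `M ^ 2 * Q`. The diagonal, adjacent
  -- and nonadjacent entries each contribute at most `d * N` or `d` per row.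
  have hM4 : ∑ a, ∑ b, G.shiftMatrix R c a b ^ 4 ≤ N * (3 * d * N) := by
    rw [sum_sum_shiftMatrix h.regular R c (fun t => t ^ 4), h.card]
    gcongr
    have e1 : (R + c) ^ 4 ≤ d * N := by
      calc (R + c) ^ 4 ≤ (2 * R) ^ 4 := by gcongr; linarith
        _ = 16 * R ^ 3 * R := by ring
        _ ≤ d * N := by gcongr <;> linarith
    have e2 : (c - 1) ^ 4 ≤ 1 := by
      have : (c - 1) ^ 2 ≤ 1 := by nlinarith
      calc (c - 1) ^ 4 = ((c - 1) ^ 2) ^ 2 := by ring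
        _ ≤ 1 := pow_le_one₀ (sq_nonneg _) this
    have e3 : c ^ 4 ≤ 1 * c := by
      rw [pow_succ]; gcongr; exact pow_le_one₀ hc0 (by linarith)
    have e4 : ((N : ℝ) - 1 - d) * c ^ 4 ≤ d := by
      calc ((N : ℝ) - 1 - d) * c ^ 4 ≤ N * (1 * c) := by gcongr; linarith
        _ ≤ d := by linarith
    have e5 : d * (c - 1) ^ 4 ≤ d * 1 := by gcongr
    nlinarith
  have hM2Q : ∑ a, ∑ b, G.shiftMatrix R c a b ^ 2 * Q a b ≤ N * d / 50 := by
    refine le_of_sq_le_sq ?_ (by positivity)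
    calc (∑ a, ∑ b, G.shiftMatrix R c a b ^ 2 * Q a b) ^ 2
        ≤ (∑ a, ∑ b, G.shiftMatrix R c a b ^ 4) * ∑ a, ∑ b, Q a b ^ 2 := by
          have := Finset.sum_mul_sq_le_sq_mul_sq (Finset.univ : Finset (V × V))
            (fun p => G.shiftMatrix R c p.1 p.2 ^ 2) (fun p => Q p.1 p.2)
          simpa only [Fintype.sum_prod_type, ← pow_mul] using this
      _ ≤ N * (3 * d * N) * (d / 10000) := by gcongr
      _ ≤ (N * d / 50) ^ 2 := by nlinarith [sq_nonneg ((N : ℝ) * d)]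
  -- The entries `c - 1 ≤ -3 / 4` on edges dominate: per row they give at most `-27 d / 64`, against
  -- at most `d / 1000` from the diagonal and `d / 16` from nonadjacent pairs.
  have hM3 : ∑ a, ∑ b, G.shiftMatrix R c a b ^ 3 ≤ N * (-(d / 3)) := by
    rw [sum_sum_shiftMatrix h.regular R c (fun t => t ^ 3), h.card]
    gcongr
    have e1 : (R + c) ^ 3 ≤ d / 1000 := by
      calc (R + c) ^ 3 ≤ (2 * R) ^ 3 := by gcongr; linarith
        _ = 8 * R ^ 3 := by ring
        _ ≤ d / 1000 := by linarith
    have e2 : (c - 1) ^ 3 ≤ -(27 / 64) := by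
      nlinarith [mul_nonneg hc0 hc0, mul_nonneg (sub_nonneg.mpr hc4) (sub_nonneg.mpr hc4)]
    have e3 : c ^ 3 ≤ (1 / 4) ^ 2 * c := by
      rw [pow_succ]; gcongr
    have e4 : ((N : ℝ) - 1 - d) * c ^ 3 ≤ (d / 16 : ℝ) := by
      calc ((N : ℝ) - 1 - d) * c ^ 3 ≤ (N * ((1 / 4) ^ 2 * c) : ℝ) := by gcongr; linarith
        _ ≤ (d / 16 : ℝ) := by linarith
    have e5 : d * (c - 1) ^ 3 ≤ d * -(27 / 64) := by gcongr
    linarith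
  -- The three correction terms total at most `(3 / 50 + 7 / 10000) N d`, less than `N d / 3`.
  have hRN : R * d ≤ N * d := by gcongr; linarith
  have hpos : (0 : ℝ) < N * d := by positivity
  linarith

/-! ### Cliques from a bound on the smallest eigenvalue. -/

theorem smallestEigenvalue_mul_le (G : SimpleGraph V) (x : V → ℝ) :
    G.smallestEigenvalue * (x ⬝ᵥ x) ≤ x ⬝ᵥ (G.adjMatrix ℝ *ᵥ x) := by
  have hA := G.isHermitian_adjMatrix ℝ
  obtain ⟨U, -, hU, hspec⟩ := hA.exists_orthogonal
  have hle : ∀ l, 0 ≤ hA.eigenvalues l - G.smallestEigenvalue := fun l =>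
    sub_nonneg.mpr (ciInf_le (Set.finite_range _).bddBelow l)
  have h1 := (posSemidef_mul_diagonal_mul_transpose U hle).dotProduct_mulVec_nonneg x
  have h2 : U * diagonal (fun l => hA.eigenvalues l - G.smallestEigenvalue) * Uᵀ =
      G.adjMatrix ℝ - G.smallestEigenvalue • (1 : Matrix V V ℝ) := by
    rw [← diagonal_sub, mul_sub, sub_mul, ← hspec]
    congr 1
    rw [← hU, ← smul_mul_assoc]
    congr 1
    ext a b
    simp [mul_diagonal, mul_comm]
  rw [h2, sub_mulVec, smul_mulVec, one_mulVec, dotProduct_sub, dotProduct_smul] at h1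
  simpa using h1

theorem smallestEigenvalue_nonpos [Nonempty V] (G : SimpleGraph V) :
    G.smallestEigenvalue ≤ 0 := by
  obtain ⟨a⟩ := ‹Nonempty V›
  simpa using G.smallestEigenvalue_mul_le (Pi.single a 1)

/-- A vertex set `U` contains a vertex with at least `d |U| / |V| + s` neighbours in `U`, where `s`
is the smallest eigenvalue. -/
theorem exists_card_filter_adj_ge {G : SimpleGraph V} {d : ℕ} (h : G.IsRegularOfDegree d)
    {U : Finset V} (hU : U.Nonempty) :
    ∃ u ∈ U, (d : ℝ) / Fintype.card V * U.card + G.smallestEigenvalue ≤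
      (U.filter (G.Adj u)).card := by
  have : Nonempty V := hU.to_type
  have hN : (0 : ℝ) < Fintype.card V := by exact_mod_cast Fintype.card_pos
  set N : ℝ := ((Fintype.card V : ℕ) : ℝ)
  set y : V → ℝ := fun a => if a ∈ U then 1 else 0 with hy
  have hysum : ∑ a, y a = U.card := by simp [hy]
  have hyy : ∑ a, y a * y a = U.card := by simp [hy]
  set z : V → ℝ := G.adjMatrix ℝ *ᵥ y with hz
  have hzsum : ∑ a, z a = d * U.card := by
    simp only [hz, mulVec, dotProduct]
    rw [Finset.sum_comm]
    simp only [← Finset.sum_mul, sum_col_adjMatrix h, ← Finset.mul_sum, hysum]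
  have hyz : ∑ a, y a * z a = ∑ u ∈ U, ((U.filter (G.Adj u)).card : ℝ) := by
    have hza : ∀ a, z a = (U.filter (G.Adj a)).card := by
      intro a
      simp only [hz, mulVec, dotProduct, adjMatrix_apply, hy, mul_ite, mul_one, mul_zero]
      rw [Finset.sum_ite_mem, Finset.univ_inter, Finset.sum_boole]
    simp only [hza, hy, ite_mul, one_mul, zero_mul]
    rw [Finset.sum_ite_mem, Finset.univ_inter]
  -- The Rayleigh bound is applied to the indicator of `U` minus its mean `t`. It shows that the
  -- average degree inside `U` is at least `d t + s (1 - t)`, and `s ≤ 0` makes this at least `d t +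
  -- s`.
  set t : ℝ := U.card / N with ht
  have htN : t * N = U.card := div_mul_cancel₀ _ hN.ne'
  have key := G.smallestEigenvalue_mul_le (fun a => y a - t)
  have h1 : (fun a => y a - t) ⬝ᵥ (fun a => y a - t) = U.card - t * U.card := by
    have : ∀ a, (y a - t) * (y a - t) = y a * y a - 2 * t * y a + t * t := fun a => by ring
    simp only [dotProduct, this, Finset.sum_add_distrib, Finset.sum_sub_distrib, hyy,
      ← Finset.mul_sum, hysum, Finset.sum_const, Finset.card_univ, nsmul_eq_mul]
    linear_combination t * htN
  have h2 : (fun a => y a - t) ⬝ᵥ (G.adjMatrix ℝ *ᵥ fun a => y a - t) =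
      ∑ u ∈ U, ((U.filter (G.Adj u)).card : ℝ) - t * (d * U.card) := by
    have hAx : ∀ a, (G.adjMatrix ℝ *ᵥ fun a => y a - t) a = z a - d * t := by
      intro a
      simp only [hz, mulVec, dotProduct, mul_sub, Finset.sum_sub_distrib, ← Finset.sum_mul,
        sum_row_adjMatrix h]
    have : ∀ a, (y a - t) * (z a - d * t) =
      y a * z a - t * z a - d * t * y a + d * t * t := fun a => by ring
    simp only [dotProduct, hAx, this, Finset.sum_add_distrib, Finset.sum_sub_distrib, hyz,
      ← Finset.mul_sum, hzsum, hysum, Finset.sum_const, Finset.card_univ, nsmul_eq_mul]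
    linear_combination d * t * htN
  rw [h1, h2] at key
  have hs := G.smallestEigenvalue_nonpos
  have ht0 : 0 ≤ t := by positivity
  by_contra! hcon
  have hlt := Finset.sum_lt_sum_of_nonempty hU hcon
  rw [Finset.sum_const, nsmul_eq_mul] at hlt
  have h3 : (U.card : ℝ) * (d / N * U.card) = t * (d * U.card) := by rw [ht]; ring
  have h4 : 0 ≤ -G.smallestEigenvalue * (t * U.card) := by
    have : 0 ≤ -G.smallestEigenvalue := by linarith
    positivity
  nlinarith

/-- A regular graph whose smallest eigenvalue is small in absolute value has large cliques. -/
theorem card_mul_density_pow_le_of_cliqueFreeOn {G : SimpleGraph V} {d : ℕ}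
    (h : G.IsRegularOfDegree d) [Nonempty V] (hd : d ≤ Fintype.card V) (t : ℕ) (U : Finset V)
    (hU : G.CliqueFreeOn U (t + 1)) :
    (U.card : ℝ) * (d / Fintype.card V) ^ t ≤ 2 ^ t * -G.smallestEigenvalue := by
  have hs := G.smallestEigenvalue_nonpos
  induction t generalizing U with
  | zero =>
    have : U = ∅ := by
      by_contra hne
      obtain ⟨u, hu⟩ := Finset.nonempty_iff_ne_empty.mpr hne
      exact hU (t := {u}) (by simpa using hu) (by simp [isNClique_iff])
    simp [this, hs]
  | succ t ih =>
    rcases U.eq_empty_or_nonempty with rfl | hne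
    · have : 0 ≤ -G.smallestEigenvalue := by linarith
      rw [Finset.card_empty, Nat.cast_zero, zero_mul]
      positivity
    obtain ⟨u, hu, hle⟩ := exists_card_filter_adj_ge h hne
    have hfree : G.CliqueFreeOn (U.filter (G.Adj u)) (t + 1) := by
      have := CliqueFreeOn.of_succ G hU (a := u) (by simpa using hu)
      refine CliqueFreeOn.subset G ?_ this
      intro x hx
      simpa using hx
    have h1 := ih _ hfree
    have hN : (0 : ℝ) < Fintype.card V := by exact_mod_cast Fintype.card_pos
    set δ : ℝ := d / Fintype.card V
    have hδ0 : 0 ≤ δ := by positivity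
    have hδ1 : δ ≤ 1 := by
      rw [div_le_one hN]; exact_mod_cast hd
    have h2 : δ ^ t ≤ 1 := pow_le_one₀ hδ0 hδ1
    have h3 : (1 : ℝ) ≤ 2 ^ t := one_le_pow₀ one_le_two
    -- Passing to the neighbours of `u` in `U` costs one further `-s`, bounded by `2 ^ t * -s`;
    -- hence the doubling of the constant.
    calc (U.card : ℝ) * δ ^ (t + 1) = δ * U.card * δ ^ t := by ring
      _ ≤ ((U.filter (G.Adj u)).card + -G.smallestEigenvalue) * δ ^ t := by
          gcongr; linarith
      _ ≤ 2 ^ t * -G.smallestEigenvalue + 2 ^ t * -G.smallestEigenvalue := by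
          rw [add_mul]
          refine add_le_add h1 ?_
          nlinarith
      _ = _ := by ring

/-- The clique bound for the whole vertex set, with `N * (d / N) = d`. -/
theorem IsApproxSRG.degree_mul_density_pow_le {G : SimpleGraph V} {N d : ℕ} {lam mu sigma : ℝ}
    (h : G.IsApproxSRG N d lam mu sigma) (hN : 0 < N) (hd : d ≤ N) {j : ℕ}
    (hfree : G.CliqueFree (j + 3)) :
    (d : ℝ) * (d / N) ^ (j + 1) ≤ 2 ^ (j + 2) * -G.smallestEigenvalue := by
  have hcard := h.card
  have : Nonempty V := Fintype.card_pos_iff.mp (by omega)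
  have := card_mul_density_pow_le_of_cliqueFreeOn h.regular (by omega) (j + 2) Finset.univ
    (hfree.cliqueFreeOn)
  rw [Finset.card_univ, hcard] at this
  refine le_trans (le_of_eq ?_) this
  have : (N : ℝ) ≠ 0 := by positivity
  rw [pow_succ _ (j + 1)]
  field_simp

/-! ### The triangle-free case. -/

theorem sum_sum_commonCount {G : SimpleGraph V} {d : ℕ} (h : G.IsRegularOfDegree d) :
    ∑ a, ∑ b, (G.commonCount a b : ℝ) = Fintype.card V * d ^ 2 := by
  simp only [← adjMatrix_mul_self_apply, mul_apply]
  have : ∀ a, ∑ b, ∑ c, G.adjMatrix ℝ a c * G.adjMatrix ℝ c b = d * d := by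
    intro a
    rw [Finset.sum_comm]
    simp only [← Finset.mul_sum, sum_row_adjMatrix h, ← Finset.sum_mul]
  simp only [this, Finset.sum_const, Finset.card_univ, nsmul_eq_mul, sq]

theorem commonCount_eq_zero_of_cliqueFree_three {G : SimpleGraph V} (hfree : G.CliqueFree 3)
    {a b : V} (hab : G.Adj a b) : G.commonCount a b = 0 := by
  rw [commonCount, Fintype.card_eq_zero_iff, Set.isEmpty_coe_sort, Set.eq_empty_iff_forall_notMem]
  intro x hx
  rw [mem_commonNeighbors] at hx
  exact hfree {a, b, x} (is3Clique_triple_iff.mpr ⟨hab, hx.1, hx.2⟩)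

/-- Here `lam = 0`, so all `N d ^ 2 - N d` walks of length two with distinct ends join nonadjacent
pairs, of which there are at most `N ^ 2`. The factor `2` absorbs the loss of `d` in `d ^ 2 - d`, as
`d ≥ 2`. -/
theorem IsApproxSRG.degree_mul_density_le_of_triangleFree {G : SimpleGraph V} {N d : ℕ}
    {lam mu sigma : ℝ} (h : G.IsApproxSRG N d lam mu sigma) (hN : 0 < N) (hd : 2 ≤ d)
    (hfree : G.CliqueFree 3) : (d : ℝ) * (d / N) ≤ 2 * (mu - lam) := by
  have hlam : lam = 0 := by
    rw [← h.mean_adj, meanCommon, Finset.sum_eq_zero, zero_div]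
    intro p hp
    rw [commonCount_eq_zero_of_cliqueFree_three hfree (Finset.mem_filter.mp hp).2, Nat.cast_zero]
  have hmu0 : 0 ≤ mu := h.mean_nonadj ▸ G.meanCommon_nonneg _
  have hsum : ∑ p ∈ G.nonadjPairs, (G.commonCount p.1 p.2 : ℝ) = N * d ^ 2 - N * d := by
    have h1 : ∀ a b, (G.commonCount a b : ℝ) =
        (if a ≠ b ∧ ¬ G.Adj a b then (G.commonCount a b : ℝ) else 0) +
          if a = b then (d : ℝ) else 0 := by
      intro a b
      by_cases hab : a = b
      · subst hab; simp [commonCount_self h.regular]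
      · by_cases hadj : G.Adj a b
        · simp [hab, hadj, commonCount_eq_zero_of_cliqueFree_three hfree hadj]
        · simp [hab, hadj]
    have h2 := sum_sum_commonCount h.regular
    rw [Finset.sum_congr rfl fun a _ => Finset.sum_congr rfl fun b _ => h1 a b] at h2
    simp only [Finset.sum_add_distrib, Finset.sum_ite_eq, Finset.mem_univ, if_true,
      Finset.sum_const, Finset.card_univ, nsmul_eq_mul, h.card] at h2
    rw [nonadjPairs, Finset.sum_filter, Fintype.sum_prod_type]
    linarith
  have hle : (N : ℝ) * d ^ 2 - N * d ≤ mu * N ^ 2 := by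
    have h3 : mu * G.nonadjPairs.card = N * d ^ 2 - N * d := by
      rw [← hsum, ← h.mean_nonadj, meanCommon]
      rcases G.nonadjPairs.eq_empty_or_nonempty with hS | hS
      · simp [hS]
      · exact div_mul_cancel₀ _ (by exact_mod_cast hS.card_pos.ne')
    rw [← h3]
    gcongr
    have := G.card_adjPairs_add_card_nonadjPairs_le
    rw [h.card] at this
    exact_mod_cast le_trans (Nat.le_add_left _ _) this
  have hN' : (0 : ℝ) < N := by exact_mod_cast hN
  have hd' : (2 : ℝ) ≤ d := by exact_mod_cast hd
  have h4 : (d : ℝ) ^ 2 - d ≤ mu * N := by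
    refine le_of_mul_le_mul_left ?_ hN'
    linarith
  rw [hlam, ← mul_div_assoc, div_le_iff₀ hN']
  nlinarith

/-! ### The bound for a single graph. -/

/-- The lower bound on the deviation from strong regularity in terms of degree and density. -/
theorem IsApproxSRG.lt_sq_of_degree_mul_density_pow_le {G : SimpleGraph V} {N d : ℕ}
    {lam mu sigma : ℝ} (h : G.IsApproxSRG N d lam mu sigma) {j : ℕ} {B : ℝ} (hB : 1 ≤ B)
    (hd : 0 < d) (hN : 4 * d ≤ N) (hτ : (d : ℝ) * (d / N) ^ (j + 1) ≤ B * (mu - lam))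
    (hK : 10000 * B ^ 3 ≤ d * ((d : ℝ) / N) ^ (3 * j + 3)) :
    (d : ℝ) * (d / N) ^ (3 * j + 5) < 10000 * B ^ 2 * sigma ^ 2 := by
  have hN0 : (0 : ℝ) < N := by exact_mod_cast (by omega : 0 < N)
  have hd0 : (0 : ℝ) < d := by exact_mod_cast hd
  have hN4 : 4 * (d : ℝ) ≤ N := by exact_mod_cast hN
  set δ : ℝ := d / N with hδ
  have hδ0 : 0 < δ := by positivity
  have hδ1 : δ ≤ 1 := by rw [hδ, div_le_one hN0]; linarith
  have hB0 : 0 < B := by linarith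
  have hp : 0 < δ ^ (j + 1) := by positivity
  have hp1 : δ ^ (j + 1) ≤ 1 := pow_le_one₀ hδ0.le hδ1
  have hτ0 : 0 < mu - lam := by
    by_contra! hneg
    have : 0 < (d : ℝ) * δ ^ (j + 1) := by positivity
    nlinarith
  -- This `R` is an upper bound for `d / (mu - lam)` by `hτ`, and `hK` says exactly `10000 * R ^ 3 ≤
  -- d`.
  have key := h.lt_sq_of_cube_le (sub_pos.mp hτ0) (R := B / δ ^ (j + 1))
    (by rw [le_div_iff₀ hp]; linarith)
    (by rw [mul_div_assoc', le_div_iff₀ hp]; linarith)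
    (by
      rw [div_pow, mul_div_assoc', div_le_iff₀ (by positivity), ← pow_mul]
      have : (j + 1) * 3 = 3 * j + 3 := by ring
      rwa [this])
    hN
  have hdN : (d : ℝ) = δ * N := by rw [hδ]; field_simp
  have h1 : d * (d * δ ^ (j + 1)) ^ 2 ≤ B ^ 2 * (d * (mu - lam) ^ 2) := by
    calc d * (d * δ ^ (j + 1)) ^ 2 ≤ d * (B * (mu - lam)) ^ 2 := by gcongr
      _ = _ := by ring
  have h2 : d * (d * δ ^ (j + 1)) ^ 2 = d * δ ^ (2 * j + 4) * N ^ 2 := by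
    have : ((d : ℝ) * δ ^ (j + 1)) ^ 2 = (δ * N * δ ^ (j + 1)) ^ 2 := by rw [← hdN]
    rw [this]; ring
  -- The argument yields the exponent `2 * j + 4`; the weaker `3 * j + 5` is the one wanted.
  have h3 : d * δ ^ (3 * j + 5) ≤ d * δ ^ (2 * j + 4) := by
    gcongr ?_ * ?_
    exact pow_le_pow_of_le_one hδ0.le hδ1 (by omega)
  refine h3.trans_lt (lt_of_mul_lt_mul_right ?_ (sq_nonneg (N : ℝ)))
  rw [← h2]
  calc _ ≤ _ := h1
    _ < B ^ 2 * (10000 * (sigma * N) ^ 2) := by gcongr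
    _ = _ := by ring

theorem cliqueFree_commonNbhdGraph {W : Type*} {G : SimpleGraph W} {i t : ℕ} {Y : Finset W}
    (hY : G.IsNClique i Y) (hfree : G.CliqueFree (i + t)) :
    (G.commonNbhdGraph Y).CliqueFree t := by
  intro C hC
  have hmap : G.IsNClique t (C.map (Function.Embedding.subtype _)) :=
    (hC.map (f := Function.Embedding.subtype _)).mono (by
      rintro a b ⟨-, x, y, hxy, rfl, rfl⟩
      exact hxy)
  have hcross : ∀ y ∈ Y, ∀ x ∈ C.map (Function.Embedding.subtype _), G.Adj y x := by
    intro y hy x hx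
    obtain ⟨c, -, rfl⟩ := Finset.mem_map.mp hx
    exact c.2 y hy
  refine hfree (Y ∪ C.map (Function.Embedding.subtype _)) ?_
  rw [isNClique_iff] at hY hmap ⊢
  refine ⟨?_, ?_⟩
  · rw [Finset.coe_union, isClique_iff, Set.pairwise_union]
    exact ⟨hY.1, hmap.1, fun a ha b hb _ =>
      ⟨hcross a (by simpa using ha) b hb, (hcross a (by simpa using ha) b hb).symm⟩⟩
  · rw [Finset.card_union_of_disjoint, hY.2, hmap.2]
    rw [Finset.disjoint_left]
    intro a ha ha'
    exact G.irrefl (hcross a ha a ha')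

end SimpleGraph

/-! ### Families of graphs and asymptotics. -/

theorem SimpleGraph.isApproxSRG_sqrt {V : Type*} [Fintype V] {G : SimpleGraph V} {N d : ℕ}
    (hcard : Fintype.card V = N) (hreg : G.IsRegularOfDegree d) (hd : 0 < d) (hN : 4 * d ≤ N) :
    G.IsApproxSRG N d (G.meanCommon G.adjPairs) (G.meanCommon G.nonadjPairs)
      √(G.varCommon G.adjPairs (G.meanCommon G.adjPairs) +
        G.varCommon G.nonadjPairs (G.meanCommon G.nonadjPairs)) := by
  have hvar : ∀ S x, 0 ≤ G.varCommon S x := fun S x =>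
    div_nonneg (Finset.sum_nonneg fun _ _ => sq_nonneg _) (Nat.cast_nonneg _)
  obtain ⟨a⟩ : Nonempty V := Fintype.card_pos_iff.mp (by omega)
  have hn : (Finset.univ.filter (G.Adj a)).card = d := by
    rw [← hreg a, ← card_neighborFinset_eq_degree]
    congr 1
    ext b; simp
  refine ⟨hcard, hreg, ?_, ?_, Real.sqrt_nonneg _, rfl, ?_, rfl, ?_⟩
  · intro htop
    have h2 : Finset.univ.filter (G.Adj a) = Finset.univ.erase a := by
      ext b; simp [htop, eq_comm]
    rw [h2, Finset.card_erase_of_mem (Finset.mem_univ a), Finset.card_univ] at hn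
    omega
  · rintro rfl
    simp at hn
    omega
  · rw [Real.sq_sqrt (add_nonneg (hvar _ _) (hvar _ _))]
    exact le_add_of_nonneg_right (hvar _ _)
  · rw [Real.sq_sqrt (add_nonneg (hvar _ _) (hvar _ _))]
    exact le_add_of_nonneg_left (hvar _ _)

/-- The second sequence is the `(e + 1)`-st power of the first. -/
theorem tendsto_mul_div_pow_of_tendsto_div_rpow {k v : ℕ → ℕ} (e : ℕ)
    (h : Tendsto (fun n => (k n : ℝ) / (v n : ℝ) ^ (1 - 1 / ((e : ℝ) + 1))) atTop atTop) :
    Tendsto (fun n => (k n : ℝ) * ((k n : ℝ) / v n) ^ e) atTop atTop := by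
  refine ((tendsto_pow_atTop e.succ_ne_zero).comp h).congr fun n => ?_
  have he : ((e : ℝ) + 1) ≠ 0 := by positivity
  have h1 : ((v n : ℝ) ^ (1 - 1 / ((e : ℝ) + 1))) ^ (e + 1) = (v n : ℝ) ^ e := by
    rw [← Real.rpow_natCast, ← Real.rpow_mul (Nat.cast_nonneg _), ← Real.rpow_natCast]
    congr 1
    push_cast
    field_simp
    ring
  simp only [Function.comp, Nat.succ_eq_add_one]
  rw [div_pow, h1, div_pow, pow_succ']
  ring

/-- Density consequences of property (P1) when `k (k / v) ^ e` tends to infinity. -/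
theorem PropertyP1.eventually_bounds {W : ℕ → Type*} [∀ n, Fintype (W n)]
    {H : ∀ n, SimpleGraph (W n)} {v k : ℕ → ℕ} {i : ℕ} {vi ki : ℕ → ℕ}
    (h : PropertyP1 H (fun n => (v n : ℝ)) (fun n => (k n : ℝ)) i vi fun n => (ki n : ℝ))
    {e : ℕ} (he : e ≠ 0) (hk : Tendsto (fun n => (k n : ℝ) * ((k n : ℝ) / v n) ^ e) atTop atTop) :
    ∀ᶠ n in atTop, 0 < ki n ∧ 4 * ki n ≤ vi n ∧ 0 < (k n : ℝ) / v n ∧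
      (k n : ℝ) * ((k n : ℝ) / v n) ^ i ≤ 2 * ki n ∧
      (k n : ℝ) / v n ≤ 2 * ((ki n : ℝ) / vi n) := by
  obtain ⟨e₁, he₁, h₁⟩ := h.degree_ge
  obtain ⟨e₂, he₂, h₂⟩ := h.density_ge
  filter_upwards [h₁, h₂, he₁.eventually_const_lt (by norm_num : (-1 / 2 : ℝ) < 0),
    he₂.eventually_const_lt (by norm_num : (-1 / 2 : ℝ) < 0),
    h.density_tendsto.eventually_lt_const (by norm_num : (0 : ℝ) < 1 / 4),
    hk.eventually_gt_atTop 0] with n h₁ h₂ he₁ he₂ hδ hT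
  have hκ : 0 < (k n : ℝ) / v n := by
    refine lt_of_le_of_ne (by positivity) fun h0 => ?_
    rw [← h0, zero_pow he, mul_zero] at hT
    exact lt_irrefl _ hT
  have hk0 : (0 : ℝ) < k n := by
    refine lt_of_le_of_ne (by positivity) fun h0 => ?_
    rw [← h0, zero_mul] at hT
    exact lt_irrefl _ hT
  have hp : 0 < (k n : ℝ) * ((k n : ℝ) / v n) ^ i := by positivity
  have hd : (k n : ℝ) * ((k n : ℝ) / v n) ^ i ≤ 2 * ki n := by nlinarith
  have hδ' : (k n : ℝ) / v n ≤ 2 * ((ki n : ℝ) / vi n) := by nlinarith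
  -- If `vi n = 0`, the quotient `ki n / vi n` is `0` by convention, against `hδ'` and `hκ`.
  have hvi : (0 : ℝ) < vi n := by
    refine lt_of_le_of_ne (by positivity) fun h0 => ?_
    rw [← h0, div_zero] at hδ'
    linarith
  refine ⟨by exact_mod_cast (by linarith : (0 : ℝ) < ki n), ?_, hκ, hd, hδ'⟩
  rw [div_lt_iff₀ hvi] at hδ
  exact_mod_cast (by linarith : 4 * (ki n : ℝ) ≤ vi n)

/-- The difference `mu - lam` is not small if (P2) holds or if the graphs are triangle-free. -/
theorem exists_degree_mul_density_pow_le {W : ℕ → Type*} [∀ n, Fintype (W n)]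
    {H : ∀ n, SimpleGraph (W n)} {j : ℕ} (hfree : ∀ n, (H n).CliqueFree (j + 3)) {vi ki : ℕ → ℕ}
    (hvi : ∀ᶠ n in atTop, 4 * ki n ≤ vi n) (hki : ∀ᶠ n in atTop, 2 ≤ ki n)
    (hP2 : PropertyP2 H vi ki ∨ j = 0) :
    ∃ B : ℝ, 1 ≤ B ∧ ∀ᶠ n in atTop, ∀ lam mu sigma : ℝ,
      (H n).IsApproxSRG (vi n) (ki n) lam mu sigma →
        (ki n : ℝ) * ((ki n : ℝ) / vi n) ^ (j + 1) ≤ B * (mu - lam) := by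
  rcases hP2 with ⟨lam, mu, sigma, hA, C, hC, hs⟩ | rfl
  · refine ⟨max 1 (2 ^ (j + 2) * C), le_max_left _ _, ?_⟩
    filter_upwards [hvi, hki, hA, hs] with n hvi hki hA hs lam' mu' sigma' hA'
    -- The means are determined by the graph, so any admissible `lam`, `mu` agree with those of
    -- (P2).
    rw [← hA'.mean_adj, ← hA'.mean_nonadj, hA.mean_adj, hA.mean_nonadj]
    have h1 := hA.degree_mul_density_pow_le (by omega) (by omega) (hfree n)
    have h2 : (ki n : ℝ) * ((ki n : ℝ) / vi n) ^ (j + 1) ≤ 2 ^ (j + 2) * C * (mu n - lam n) := by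
      refine h1.trans ?_
      rw [mul_assoc]
      gcongr
    have h3 : 0 ≤ mu n - lam n := by
      have h0 : 0 ≤ 2 ^ (j + 2) * C * (mu n - lam n) := le_trans (by positivity) h2
      exact nonneg_of_mul_nonneg_right h0 (by positivity)
    exact h2.trans (mul_le_mul_of_nonneg_right (le_max_right _ _) h3)
  · refine ⟨2, one_le_two, ?_⟩
    filter_upwards [hvi, hki] with n hvi hki lam mu sigma hA
    simpa using hA.degree_mul_density_le_of_triangleFree (by omega) hki (hfree n)

theorem mainTheorem3 (m i : ℕ) (hi : i + 3 ≤ m)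
    {V : ℕ → Type*} [∀ n, Fintype (V n)] (G : ∀ n, SimpleGraph (V n))
    (v k : ℕ → ℕ) (hv : ∀ n, Fintype.card (V n) = v n)
    (hG : OptimallyPseudorandom G k)
    (hfree : ∀ n, (G n).CliqueFree m)
    (hk : Tendsto
      (fun n => (k n : ℝ) / (v n : ℝ) ^ (1 - 1 / (3 * (m : ℝ) - 2 * (i : ℝ) - 5))) atTop atTop)
    (Y : ∀ n, Finset (V n)) (hY : ∀ n, (G n).IsNClique i (Y n))
    (vi ki : ℕ → ℕ)
    (hreg : ∀ n, ((G n).commonNbhdGraph (Y n)).IsRegularOfDegree (ki n))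
    (hP1 : PropertyP1 (fun n => (G n).commonNbhdGraph (Y n))
      (fun n => (v n : ℝ)) (fun n => (k n : ℝ)) i vi (fun n => (ki n : ℝ)))
    (hP2 : PropertyP2 (fun n => (G n).commonNbhdGraph (Y n)) vi ki ∨ i = m - 3) :
    (∃ lam mu sigma : ℕ → ℝ, ∀ᶠ n in atTop,
      ((G n).commonNbhdGraph (Y n)).IsApproxSRG (vi n) (ki n) (lam n) (mu n) (sigma n)) ∧
    ∀ lam mu sigma : ℕ → ℝ,
      (∀ᶠ n in atTop,
        ((G n).commonNbhdGraph (Y n)).IsApproxSRG (vi n) (ki n) (lam n) (mu n) (sigma n)) →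
      ∃ c : ℝ, 0 < c ∧ ∀ᶠ n in atTop,
        c * (√(k n : ℝ) * ((k n : ℝ) / (v n : ℝ)) ^ (3 / 2 * (m : ℝ) - 2 - (i : ℝ))) ≤ sigma n := by
  obtain ⟨j, rfl⟩ := Nat.exists_eq_add_of_le hi
  -- With `m = i + 3 + j`, the exponent is `3 m - 2 i - 6`.
  have hT : Tendsto (fun n => (k n : ℝ) * ((k n : ℝ) / v n) ^ (i + 3 * j + 3)) atTop atTop := by
    refine tendsto_mul_div_pow_of_tendsto_div_rpow _ (hk.congr fun n => ?_)
    congr 4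
    push_cast
    ring
  have hbd := hP1.eventually_bounds (by omega) hT
  have hreg' : ∀ n, ((G n).commonNbhdGraph (Y n)).IsRegularOfDegree (ki n) := hreg
  have hfree' : ∀ n, ((G n).commonNbhdGraph (Y n)).CliqueFree (j + 3) := fun n =>
    SimpleGraph.cliqueFree_commonNbhdGraph (hY n) (by convert hfree n using 1; omega)
  refine ⟨⟨_, _, _, hbd.mono fun n hn =>
    SimpleGraph.isApproxSRG_sqrt (hP1.card_vertices n) (hreg' n) hn.1 hn.2.1⟩, ?_⟩
  intro lam mu sigma hA
  -- The degree accounts for the factor `(k / v) ^ i`. Replacing it and the `3 * j + 3` densities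
  -- costs a factor `2` each.
  have hdeg : ∀ K : ℝ, ∀ᶠ n in atTop, K ≤ ki n * ((ki n : ℝ) / vi n) ^ (3 * j + 3) := by
    intro K
    filter_upwards [hbd, hT.eventually_ge_atTop (2 ^ (3 * j + 4) * K)] with n hn hK
    obtain ⟨-, -, hκ, hd, hδ⟩ := hn
    have h1 : (2 : ℝ) ^ (3 * j + 4) * K ≤
        2 ^ (3 * j + 4) * (ki n * ((ki n : ℝ) / vi n) ^ (3 * j + 3)) := by
      calc _ ≤ _ := hK
        _ = (k n * ((k n : ℝ) / v n) ^ i) * ((k n : ℝ) / v n) ^ (3 * j + 3) := by ring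
        _ ≤ (2 * ki n) * (2 * ((ki n : ℝ) / vi n)) ^ (3 * j + 3) := by gcongr
        _ = _ := by rw [mul_pow]; ring
    exact le_of_mul_le_mul_left h1 (by positivity)
  have hki : ∀ᶠ n in atTop, 2 ≤ ki n := by
    filter_upwards [hbd, hdeg 2] with n hn h2
    have h3 : (ki n : ℝ) / vi n ≤ 1 := by
      refine div_le_one_of_le₀ ?_ (Nat.cast_nonneg _)
      exact_mod_cast (by omega : ki n ≤ vi n)
    have h4 : ((ki n : ℝ) / vi n) ^ (3 * j + 3) ≤ 1 := pow_le_one₀ (by positivity) h3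
    exact_mod_cast h2.trans (mul_le_of_le_one_right (Nat.cast_nonneg _) h4)
  obtain ⟨B, hB, hτ⟩ := exists_degree_mul_density_pow_le hfree' (hbd.mono fun n hn => hn.2.1) hki
    (hP2.imp_right fun h => by omega)
  have hB0 : 0 < B := by linarith
  -- Here `100 * B` is the root of `10000 * B ^ 2`. The power of `2` is the transfer loss, kept
  -- whole to avoid taking its root.
  refine ⟨1 / (100 * B * 2 ^ (3 * j + 6)), by positivity, ?_⟩
  filter_upwards [hbd, hτ, hA, hdeg (10000 * B ^ 3)] with n hn hτ hA hK
  obtain ⟨hd0, hN, hκ, hd, hδ⟩ := hn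
  have hlt := hA.lt_sq_of_degree_mul_density_pow_le hB hd0 hN (hτ _ _ _ hA) hK
  set κ : ℝ := (k n : ℝ) / v n
  have h1 : k n * κ ^ (i + 3 * j + 5) ≤ 2 ^ (3 * j + 6) * (10000 * B ^ 2 * sigma n ^ 2) := by
    calc k n * κ ^ (i + 3 * j + 5) = (k n * κ ^ i) * κ ^ (3 * j + 5) := by ring
      _ ≤ (2 * ki n) * (2 * ((ki n : ℝ) / vi n)) ^ (3 * j + 5) := by gcongr
      _ = 2 ^ (3 * j + 6) * (ki n * ((ki n : ℝ) / vi n) ^ (3 * j + 5)) := by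
          rw [mul_pow]; ring
      _ ≤ _ := by gcongr
  have h2 : (κ ^ (3 / 2 * ((i + 3 + j : ℕ) : ℝ) - 2 - (i : ℝ))) ^ 2 = κ ^ (i + 3 * j + 5) := by
    rw [← Real.rpow_natCast, ← Real.rpow_mul hκ.le, ← Real.rpow_natCast]
    congr 1
    push_cast
    ring
  refine le_of_sq_le_sq ?_ hA.sigma_nonneg
  rw [mul_pow, mul_pow, h2, Real.sq_sqrt (Nat.cast_nonneg _), div_pow, one_pow, one_div,
    inv_mul_le_iff₀ (by positivity)]
  refine h1.trans ?_
  have h3 : (1 : ℝ) ≤ 2 ^ (3 * j + 6) := one_le_pow₀ one_le_two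
  have h4 : (2 : ℝ) ^ (3 * j + 6) ≤ (2 ^ (3 * j + 6)) ^ 2 := le_self_pow₀ h3 two_ne_zero
  calc (2 : ℝ) ^ (3 * j + 6) * (10000 * B ^ 2 * sigma n ^ 2)
      ≤ (2 ^ (3 * j + 6)) ^ 2 * (10000 * B ^ 2 * sigma n ^ 2) := by gcongr
    _ = _ := by ring
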